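/- Let $A$ and $B$ be $C^*$-algebras. A right Hilbert $A$-module $X_A$ is a right $A$-module with an $A$-valued inner product $(\cdot\mid\cdot)_A$ (linear in the second variable) that is complete in the induced norm. Write $\mathrm{End}_A(X)$ for its $C^*$-algebra of adjointable operators, $\Theta_{x,y}$ for the rank-one operator $\Theta_{x,y}(z)=x\cdot(y\mid z)_A$, and $\mathrm{End}^0_A(X)$ for the closed linear span of the $\Theta_{x,y}$. A net $(T_\lambda)$ in $\mathrm{End}_A(X)$ converges strictly to $T$ if $\|T_\lambda K-TK\|\to 0$ and $\|KT_\lambda-KT\|\to 0$ for every $K\in\mathrm{End}^0_A(X)$. A sequence $(x_j)_{j\in\mathbb N}$ in $X_A$ is a countable frame for $X_A$ if the partial sums of $\sum_{j}\Theta_{x_j,x_j}$ converge strictly to the identity operator. **Proposition.** Let $X_A$ be a right Hilbert $A$-module and let $(\phi,{}_AY_B)$ be an $A$–$B$-correspondence, that is, $Y_B$ is a right Hilbert $B$-module and $\phi\colon A\to\mathrm{End}_B(Y)$ is a $*$-homomorphism. Let $(x_i)_{i\in\mathbb N}$ be a countable frame for $X_A$ and let $(y_j)_{j\in\mathbb N}$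 be a countable frame for $Y_B$. Then $(x_i\otimes y_j)_{i,j\in\mathbb N}$ is a countable frame for the interior tensor product $X\otimes_\phi Y$, the right Hilbert $B$-module obtained by separating and completing the algebraic tensor product with respect to $(x\otimes y\mid x'\otimes y')_B=(y\mid\phi((x\mid x')_A)\,y')_B$. More precisely, the net of sums $\sum_{(i,j)\in\Sigma}\Theta_{x_i\otimes y_j,\,x_i\otimes y_j}$ over the finite subsets $\Sigma\subset\mathbb N^2$, directed by inclusion, converges strictly to the identity of $\mathrm{End}_B(X\otimes_\phi Y)$, and $(x_i\otimes y_j)$ arranged in a sequence by any bijection $\mathbb N\to\mathbb N^2$ is a countable frame. -/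

import Mathlib

open MulOpposite Filter Topology
open scoped TensorProduct InnerProductSpace

noncomputable section

/-!
Conventions.  A right Hilbert module over a `C⋆`-algebra `A` is a Banach space `X` with
`CStarModule Aᵐᵒᵖ X`: the right action is `x · a = op a • x`, the `A`-valued inner product,
conjugate linear in the first and `A`-linear in the second variable, is
`(x | y)_A = unop ⟪x, y⟫_Aᵐᵒᵖ`.  Statements that do not use the order of multiplication are
written for `CStarModule C E` with `C` arbitrary, to be read with `C = Aᵐᵒᵖ`.
-/

namespace HilbertModule

section Basic

variable (C : Type*) {E : Type*} [NonUnitalCStarAlgebra C] [PartialOrder C] [StarOrderedRing C]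
  [NormedAddCommGroup E] [NormedSpace ℂ E] [SMul C E] [CStarModule C E]

theorem ext_inner {x y : E} (h : ∀ z : E, ⟪z, x⟫_C = ⟪z, y⟫_C) : x = y := by
  rw [← sub_eq_zero]
  apply (CStarModule.inner_self (A := C)).mp
  rw [CStarModule.inner_sub_right, h, sub_self]

theorem smul_add' (c : C) (x y : E) : c • (x + y) = c • x + c • y :=
  ext_inner C fun z => by simp [mul_add]

theorem smul_neg' (c : C) (x : E) : c • (-x) = -(c • x) :=
  ext_inner C fun z => by simp

theorem smul_sub' (c : C) (x y : E) : c • (x - y) = c • x - c • y :=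
  ext_inner C fun z => by simp [mul_sub]

theorem add_smul' (c d : C) (x : E) : (c + d) • x = c • x + d • x :=
  ext_inner C fun z => by simp [add_mul]

theorem smul_complex_smul (c : C) (t : ℂ) (x : E) : c • (t • x) = t • (c • x) :=
  ext_inner C fun z => by simp [mul_smul_comm]

theorem complex_smul_smul (c : C) (t : ℂ) (x : E) : (t • c) • x = t • (c • x) :=
  ext_inner C fun z => by simp [smul_mul_assoc]

theorem norm_smul_le' (c : C) (x : E) : ‖c • x‖ ≤ ‖c‖ * ‖x‖ := by
  refine abs_le_of_sq_le_sq' ?_ (by positivity) |>.2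
  rw [CStarModule.norm_sq_eq C, mul_pow, CStarModule.norm_sq_eq C (x := x)]
  calc ‖⟪c • x, c • x⟫_C‖ = ‖c * (⟪x, x⟫_C * star c)‖ := by simp
    _ ≤ ‖c‖ * (‖⟪x, x⟫_C‖ * ‖star c‖) :=
        (norm_mul_le _ _).trans (by gcongr; exact norm_mul_le _ _)
    _ = ‖c‖ ^ 2 * ‖⟪x, x⟫_C‖ := by rw [norm_star]; ring

variable (E)

/-- The algebra `End_C(E)` of adjointable operators on the Hilbert module `E`,
with the operator norm. -/
def Adjointable : Subalgebra ℂ (E →L[ℂ] E) where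
  carrier := {T | ∃ S : E →L[ℂ] E, ∀ x y : E, ⟪T x, y⟫_C = ⟪x, S y⟫_C}
  mul_mem' := by
    rintro T T' ⟨S, hS⟩ ⟨S', hS'⟩
    exact ⟨S' * S, fun x y => by simp [hS, hS']⟩
  add_mem' := by
    rintro T T' ⟨S, hS⟩ ⟨S', hS'⟩
    exact ⟨S + S', fun x y => by simp [hS, hS']⟩
  algebraMap_mem' t := ⟨star t • 1, fun x y => by
    simp [Algebra.algebraMap_eq_smul_one]⟩

variable {C E}

namespace Adjointable

/-- The adjoint of an adjointable operator. -/
instance : Star (Adjointable C E) where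
  star T := ⟨T.2.choose, T.1, fun x y => by
    rw [← CStarModule.star_inner, ← T.2.choose_spec, CStarModule.star_inner]⟩

theorem inner_left (T : Adjointable C E) (x y : E) :
    ⟪T.1 x, y⟫_C = ⟪x, (star T).1 y⟫_C :=
  T.2.choose_spec x y

theorem inner_right (T : Adjointable C E) (x y : E) :
    ⟪x, T.1 y⟫_C = ⟪(star T).1 x, y⟫_C := by
  rw [← CStarModule.star_inner, inner_left, CStarModule.star_inner]

theorem eq_star {T S : Adjointable C E} (h : ∀ x y : E, ⟪T.1 x, y⟫_C = ⟪x, S.1 y⟫_C) :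
    star T = S :=
  Subtype.ext <| ContinuousLinearMap.ext fun y => ext_inner C fun x => by
    rw [← inner_left, h]

instance : StarRing (Adjointable C E) where
  star_involutive T := eq_star fun x y => by rw [inner_right]
  star_mul T S := eq_star fun x y => by
    simp only [MulMemClass.coe_mul, mul_apply_eq_comp, inner_left]
  star_add T S := eq_star fun x y => by
    simp only [Subalgebra.coe_add, add_apply, inner_left,
      CStarModule.inner_add_left, CStarModule.inner_add_right]

end Adjointable

/-- The rank-one operator `Θ_{x,y} z = x · (y | z)`. -/
def rankOne (x y : E) : Adjointable C E :=
  ⟨LinearMap.mkContinuous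
    { toFun := fun z => ⟪y, z⟫_C • x
      map_add' := fun z w => by rw [CStarModule.inner_add_right, add_smul']
      map_smul' := fun t z => by
        rw [CStarModule.inner_smul_right_complex, complex_smul_smul, RingHom.id_apply] }
    (‖y‖ * ‖x‖) (fun z => (norm_smul_le' C _ _).trans <| by
      have := CStarModule.norm_inner_le (A := C) E (x := y) (y := z)
      calc ‖⟪y, z⟫_C‖ * ‖x‖ ≤ (‖y‖ * ‖z‖) * ‖x‖ := by gcongr
        _ = ‖y‖ * ‖x‖ * ‖z‖ := by ring),
   LinearMap.mkContinuous
    { toFun := fun z => ⟪x, z⟫_C • y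
      map_add' := fun z w => by rw [CStarModule.inner_add_right, add_smul']
      map_smul' := fun t z => by
        rw [CStarModule.inner_smul_right_complex, complex_smul_smul, RingHom.id_apply] }
    (‖x‖ * ‖y‖) (fun z => (norm_smul_le' C _ _).trans <| by
      have := CStarModule.norm_inner_le (A := C) E (x := x) (y := z)
      calc ‖⟪x, z⟫_C‖ * ‖y‖ ≤ (‖x‖ * ‖z‖) * ‖y‖ := by gcongr
        _ = ‖x‖ * ‖y‖ * ‖z‖ := by ring),
   fun z w => by
    simp⟩

theorem rankOne_apply (x y z : E) : (rankOne (C := C) x y).1 z = ⟪y, z⟫_C • x := rfl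

variable (C E)

/-- The ideal `End⁰_C(E)` of generalised compact operators: the operator norm closure of the
finite-rank operators, i.e. of the linear span of the rank-one operators. -/
def compacts : Submodule ℂ (Adjointable C E) :=
  (Submodule.span ℂ (Set.range fun p : E × E => rankOne (C := C) p.1 p.2)).topologicalClosure

/-- The strict topology on `End_C(E)`, the multiplier algebra of `End⁰_C(E)`: the coarsest
topology for which `T ↦ T K` and `T ↦ K T` are norm continuous for all generalised compact `K`. -/
abbrev strictTopology : TopologicalSpace (Adjointable C E) :=
  TopologicalSpace.induced (fun T (K : compacts C E) => (T * K.1, K.1 * T)) inferInstance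

variable {E}

/-- `(x_j)_{j ∈ ℕ}` is a countable frame: the partial sums of `∑ Θ_{x_j, x_j}` converge strictly
to the identity operator. -/
def IsCountableFrame (x : ℕ → E) : Prop :=
  Tendsto (fun n => ∑ j ∈ Finset.range n, rankOne (C := C) (x j) (x j)) atTop
    (@nhds _ (strictTopology C E) 1)

/-- A frame indexed by a set `ι` without a preferred order: the net of the sums of
`Θ_{x_i, x_i}` over the finite subsets of `ι` converges strictly to the identity operator. -/
def IsUnorderedFrame {ι : Type*} (x : ι → E) : Prop :=
  Tendsto (fun s : Finset ι => ∑ i ∈ s, rankOne (C := C) (x i) (x i)) atTop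
    (@nhds _ (strictTopology C E) 1)

end Basic

/-! ### Completion of an inner product module -/

section Completion

open UniformSpace

variable {C E : Type*} [NonUnitalCStarAlgebra C] [PartialOrder C] [StarOrderedRing C]
  [NormedAddCommGroup E] [NormedSpace ℂ E] [SMul C E] [CStarModule C E]

theorem uniformContinuousConstSMul : UniformContinuousConstSMul C E where
  uniformContinuous_const_smul c := by
    refine (LipschitzWith.of_dist_le_mul (K := ‖c‖₊) fun x y => ?_).uniformContinuous
    rw [dist_eq_norm, dist_eq_norm, ← smul_sub' C]
    exact norm_smul_le' C c (x - y)

theorem completion_coe_smul (c : C) (x : E) : ((c • x : E) : Completion E) = c • (x : Completion E) :=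
  haveI := uniformContinuousConstSMul (C := C) (E := E)
  Completion.coe_smul c x

theorem completion_continuous_smul (c : C) : Continuous fun x : Completion E => c • x :=
  haveI := uniformContinuousConstSMul (C := C) (E := E)
  continuous_const_smul c

theorem completion_inner_coe (x y : E) :
    ⟪(x : Completion E), (y : Completion E)⟫_C = ⟪x, y⟫_C :=
  (Completion.isDenseInducing_coe.prodMap Completion.isDenseInducing_coe).extend_eq
    (CStarModule.continuous_inner : Continuous fun p : E × E => ⟪p.1, p.2⟫_C) (x, y)

theorem completion_continuous_inner :
    Continuous (Function.uncurry (inner C (E := Completion E))) := by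
  let inner' : E →+ E →+ C :=
    { toFun := fun x => (CStarModule.innerₛₗ (A := C) x).toAddMonoidHom
      map_zero' := by ext x; exact CStarModule.inner_zero_left
      map_add' := fun x y => by ext z; exact CStarModule.inner_add_left }
  have h : Continuous fun p : E × E => inner' p.1 p.2 :=
    (CStarModule.continuous_inner : Continuous fun p : E × E => ⟪p.1, p.2⟫_C)
  rw [Completion.toInner, inner, Function.uncurry_curry _]
  change
    Continuous
      (((Completion.isDenseInducing_toCompl E).prodMap
        (Completion.isDenseInducing_toCompl E)).extend fun p : E × E => inner' p.1 p.2)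
  exact (Completion.isDenseInducing_toCompl E).extend_Z_bilin
    (Completion.isDenseInducing_toCompl E) h

theorem completion_continuous_inner' {T : Type*} [TopologicalSpace T] {f g : T → Completion E}
    (hf : Continuous f) (hg : Continuous g) : Continuous fun t => ⟪f t, g t⟫_C :=
  completion_continuous_inner.comp (hf.prodMk hg)

theorem completion_norm_eq (x : Completion E) : ‖x‖ = √‖⟪x, x⟫_C‖ :=
  Completion.induction_on x
    (isClosed_eq continuous_norm
      (completion_continuous_inner' continuous_id continuous_id).norm.sqrt)
    fun a => by
      rw [Completion.norm_coe, completion_inner_coe, CStarModule.norm_eq_sqrt_norm_inner_self (A := C)]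

/-- The completion of an inner product `C`-module is a Hilbert `C`-module; action and inner
product are the continuous extensions. -/
instance completionCStarModule : CStarModule C (Completion E) where
  inner_add_right {x y z} :=
    Completion.induction_on₃ x y z
      (isClosed_eq
        (completion_continuous_inner' (by fun_prop) (by fun_prop))
        ((completion_continuous_inner' (by fun_prop) (by fun_prop)).add
          (completion_continuous_inner' (by fun_prop) (by fun_prop))))
      fun a b c => by
        rw [← Completion.coe_add]
        simp only [completion_inner_coe, CStarModule.inner_add_right]
  inner_self_nonneg {x} :=
    Completion.induction_on x
      (isClosed_le continuous_const (completion_continuous_inner' continuous_id continuous_id))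
      fun a => by rw [completion_inner_coe]; exact CStarModule.inner_self_nonneg
  inner_self {x} := by
    rw [← norm_eq_zero (a := x), completion_norm_eq (C := C), Real.sqrt_eq_zero (norm_nonneg _),
      norm_eq_zero]
  inner_op_smul_right {c x y} :=
    Completion.induction_on₂ x y
      (isClosed_eq
        (completion_continuous_inner' continuous_fst
          ((completion_continuous_smul c).comp continuous_snd))
        (continuous_const.mul (completion_continuous_inner' continuous_fst continuous_snd)))
      fun a b => by
        rw [← completion_coe_smul]
        simp only [completion_inner_coe, CStarModule.inner_op_smul_right]
  inner_smul_right_complex {t x y} :=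
    Completion.induction_on₂ x y
      (isClosed_eq
        (completion_continuous_inner' continuous_fst (continuous_snd.const_smul t))
        ((completion_continuous_inner' continuous_fst continuous_snd).const_smul t))
      fun a b => by
        rw [← Completion.coe_smul]
        simp only [completion_inner_coe, CStarModule.inner_smul_right_complex]
  star_inner x y :=
    Completion.induction_on₂ x y
      (isClosed_eq
        (completion_continuous_inner' continuous_fst continuous_snd).star
        (completion_continuous_inner' continuous_snd continuous_fst))
      fun a b => by simp only [completion_inner_coe, CStarModule.star_inner]
  norm_eq_sqrt_norm_inner_self x := completion_norm_eq x

end Completion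

/-! ### The interior tensor product -/

section Positivity

variable {A : Type*} [NonUnitalCStarAlgebra A] [PartialOrder A] [StarOrderedRing A]

theorem nonneg_factor {G : A} (hG : 0 ≤ G) : ∃ c : A, G = star c * c :=
  CStarAlgebra.nonneg_iff_eq_star_mul_self.mp hG

theorem matrix_eq_zero_of_diag {n : Type*} [Fintype n] [DecidableEq n] (P : CStarMatrix n n A)
    (hP : 0 ≤ P) (h : ∀ k, P k k ≤ 0) : P = 0 := by
  obtain ⟨d, rfl⟩ := nonneg_factor hP
  have hd : d = 0 := by
    ext i k
    have h1 : ∑ j, star (d j k) * d j k ≤ 0 := h k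
    have h2 : star (d i k) * d i k ≤ 0 :=
      (Finset.single_le_sum (f := fun j => star (d j k) * d j k)
        (fun j _ => star_mul_self_nonneg _) (Finset.mem_univ i)).trans h1
    exact (CStarRing.star_mul_self_eq_zero_iff _).mp (le_antisymm h2 (star_mul_self_nonneg _))
  rw [hd, mul_zero]

theorem exists_negPart (G : A) (hsa : IsSelfAdjoint G) :
    ∃ N : A, IsSelfAdjoint N ∧ N * G * N = -(N * N * N) ∧ 0 ≤ N * N * N ∧
      (N * N * N = 0 → 0 ≤ G) := by
  have hneg : IsSelfAdjoint G⁻ := (CFC.negPart_nonneg G).isSelfAdjoint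
  refine ⟨G⁻, hneg, ?_, ?_, fun h => ?_⟩
  · have h : G⁻ * G = -(G⁻ * G⁻) := by
      conv_lhs =>
        rhs
        rw [← CFC.posPart_sub_negPart G hsa]
      rw [mul_sub, CFC.negPart_mul_posPart, zero_sub]
    rw [h, neg_mul]
  · have := star_left_conjugate_nonneg (CFC.negPart_nonneg G) G⁻
    rwa [hneg.star_eq] at this
  · have h7 : star (G⁻ * G⁻) * (G⁻ * G⁻) = 0 := by
      rw [star_mul, hneg.star_eq, ← mul_assoc, h, zero_mul]
    have h8 : star (G⁻) * G⁻ = 0 := by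
      rw [hneg.star_eq]; exact (CStarRing.star_mul_self_eq_zero_iff _).mp h7
    rw [← CFC.posPart_sub_negPart G hsa, (CStarRing.star_mul_self_eq_zero_iff _).mp h8, sub_zero]
    exact CFC.posPart_nonneg G

theorem matrix_factor {n : Type*} [Fintype n] [DecidableEq n] (G : CStarMatrix n n A)
    (hsa : star G = G) (hG : ∀ a : n → A, 0 ≤ ∑ i, ∑ j, star (a i) * G i j * a j) :
    ∃ c : CStarMatrix n n A, ∀ i j, G i j = ∑ k, star (c k i) * c k j := by
  obtain ⟨N, hN, h3, hcube, hpos⟩ := exists_negPart G hsa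
  have hzero : N * N * N = 0 := by
    refine matrix_eq_zero_of_diag _ hcube fun k => ?_
    have h4 : (N * G * N) k k = ∑ i, ∑ j, star (N i k) * G i j * N j k := by
      have h5 : ∀ i, N k i = star (N i k) := fun i => by
        conv_lhs => rw [← hN.star_eq]
        rfl
      rw [CStarMatrix.mul_apply, Finset.sum_comm]
      refine Finset.sum_congr rfl fun j _ => ?_
      rw [CStarMatrix.mul_apply, Finset.sum_mul]
      exact Finset.sum_congr rfl fun i _ => by rw [h5]
    have h6 : 0 ≤ (N * G * N) k k := h4 ▸ hG fun i => N i k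
    rw [h3] at h6
    exact neg_nonneg.mp h6
  obtain ⟨c, hc⟩ := nonneg_factor (hpos hzero)
  exact ⟨c, fun i j => by rw [congrFun (congrFun hc i) j]; rfl⟩

end Positivity

section InteriorTensor

variable {A C : Type*} [NonUnitalCStarAlgebra A] [PartialOrder A] [StarOrderedRing A]
  [NonUnitalCStarAlgebra C] [PartialOrder C] [StarOrderedRing C]
  (X : Type*) [NormedAddCommGroup X] [NormedSpace ℂ X] [SMul Aᵐᵒᵖ X] [CStarModule Aᵐᵒᵖ X]
  {Y : Type*} [NormedAddCommGroup Y] [NormedSpace ℂ Y] [SMul C Y] [CStarModule C Y]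
  (φ : A →⋆ₙₐ[ℂ] Adjointable C Y)

/-- The sesquilinear form `(x ⊗ y | x' ⊗ y') = (y | φ((x | x')_A) y')` on the algebraic tensor
product of a right Hilbert `A`-module `X` and a correspondence `Y`. -/
def tensorForm : X ⊗[ℂ] Y →ₗ⋆[ℂ] X ⊗[ℂ] Y →ₗ[ℂ] C :=
  TensorProduct.lift <| LinearMap.mk₂'ₛₗ (starRingEnd ℂ) (starRingEnd ℂ)
    (fun x y => TensorProduct.lift <| LinearMap.mk₂ ℂ
      (fun x' y' => ⟪y, (φ (unop ⟪x, x'⟫_Aᵐᵒᵖ)).1 y'⟫_C)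
      (fun x₁ x₂ y' => by simp)
      (fun t x' y' => by simp)
      (fun x' y₁ y₂ => by simp)
      (fun t x' y' => by simp))
    (fun x₁ x₂ y => TensorProduct.ext' fun x' y' => by simp)
    (fun t x y => TensorProduct.ext' fun x' y' => by simp)
    (fun x y₁ y₂ => TensorProduct.ext' fun x' y' => by simp)
    (fun t x y => TensorProduct.ext' fun x' y' => by simp)

variable {X}

theorem tensorForm_tmul (x x' : X) (y y' : Y) :
    tensorForm X φ (x ⊗ₜ y) (x' ⊗ₜ y') = ⟪y, (φ (unop ⟪x, x'⟫_Aᵐᵒᵖ)).1 y'⟫_C := rfl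

theorem star_tensorForm (u v : X ⊗[ℂ] Y) : star (tensorForm X φ u v) = tensorForm X φ v u := by
  induction u with
  | zero => simp
  | add u₁ u₂ h₁ h₂ => simp [h₁, h₂]
  | tmul x y =>
    induction v with
    | zero => simp
    | add v₁ v₂ h₁ h₂ => simp [h₁, h₂]
    | tmul x' y' =>
      rw [tensorForm_tmul, tensorForm_tmul, CStarModule.star_inner, Adjointable.inner_left,
        ← map_star, ← unop_star, CStarModule.star_inner]

theorem tensorForm_self_nonneg (u : X ⊗[ℂ] Y) : 0 ≤ tensorForm X φ u u := by
  classical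
  obtain ⟨n, x, y, rfl⟩ := TensorProduct.exists_sum_tmul_eq u
  obtain ⟨c, hc⟩ := matrix_factor
    (CStarMatrix.ofMatrix fun i j : Fin n => unop ⟪x i, x j⟫_Aᵐᵒᵖ)
    (by
      ext i j
      change star (unop ⟪x j, x i⟫_Aᵐᵒᵖ) = unop ⟪x i, x j⟫_Aᵐᵒᵖ
      rw [← unop_star, CStarModule.star_inner])
    (fun a => by
      have h : 0 ≤ unop ⟪∑ i, op (a i) • x i, ∑ i, op (a i) • x i⟫_Aᵐᵒᵖ :=
        (CStarModule.inner_self_nonneg : (0 : Aᵐᵒᵖ) ≤ _)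
      simp only [CStarModule.inner_sum_left, CStarModule.inner_sum_right,
        CStarModule.inner_op_smul_right, CStarModule.inner_op_smul_left] at h
      simp only [Finset.mul_sum] at h
      rw [Finset.sum_comm] at h
      change 0 ≤ ∑ i, ∑ j, star (a i) * unop ⟪x i, x j⟫_Aᵐᵒᵖ * a j
      simpa [Finset.unop_sum, mul_assoc] using h)
  have hc' : ∀ i j, unop ⟪x i, x j⟫_Aᵐᵒᵖ = ∑ k, star (c k i) * c k j := hc
  have h : tensorForm X φ (∑ i, x i ⊗ₜ y i) (∑ i, x i ⊗ₜ y i) =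
      ∑ k, ⟪∑ i, (φ (c k i)).1 (y i), ∑ i, (φ (c k i)).1 (y i)⟫_C := by
    simp only [map_sum, LinearMap.sum_apply, tensorForm_tmul, hc', map_mul, map_star,
      CStarModule.inner_sum_left, CStarModule.inner_sum_right]
    have h2 : ∀ i j, ⟪y i, (∑ k, star (φ (c k i)) * φ (c k j) : Adjointable C Y).1 (y j)⟫_C =
        ∑ k, ⟪(φ (c k i)).1 (y i), (φ (c k j)).1 (y j)⟫_C := fun i j => by
      simp [Adjointable.inner_left]
    simp only [h2]
    rw [Finset.sum_congr rfl fun j _ => Finset.sum_comm, Finset.sum_comm]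
  rw [h]
  exact Finset.sum_nonneg fun k _ => CStarModule.inner_self_nonneg

/-- The right action on the algebraic tensor product, `(x ⊗ y) · b = x ⊗ (y · b)`. -/
def tensorAct (c : C) : X ⊗[ℂ] Y →ₗ[ℂ] X ⊗[ℂ] Y :=
  LinearMap.lTensor X
    { toFun := fun y => c • y
      map_add' := fun y y' => smul_add' C c y y'
      map_smul' := fun t y => smul_complex_smul C c t y }

theorem tensorForm_act (c : C) (u v : X ⊗[ℂ] Y) :
    tensorForm X φ u (tensorAct c v) = c * tensorForm X φ u v := by
  induction u with
  | zero => simp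
  | add u₁ u₂ h₁ h₂ => simp [h₁, h₂, mul_add]
  | tmul x y =>
    induction v with
    | zero => simp
    | add v₁ v₂ h₁ h₂ => simp [h₁, h₂, mul_add]
    | tmul x' y' =>
      change ⟪y, (φ (unop ⟪x, x'⟫_Aᵐᵒᵖ)).1 (c • y')⟫_C =
        c * ⟪y, (φ (unop ⟪x, x'⟫_Aᵐᵒᵖ)).1 y'⟫_C
      rw [Adjointable.inner_right, CStarModule.inner_op_smul_right, Adjointable.inner_right]

theorem tensorForm_act_left (c : C) (u v : X ⊗[ℂ] Y) :
    tensorForm X φ (tensorAct c u) v = tensorForm X φ u v * star c := by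
  rw [← star_tensorForm, tensorForm_act, star_mul, star_tensorForm]

theorem tensorForm_eq_zero {u : X ⊗[ℂ] Y} (hu : tensorForm X φ u u = 0) (v : X ⊗[ℂ] Y) :
    tensorForm X φ v u = 0 := by
  set w := tensorForm X φ v u with hw
  have key : ∀ n : ℕ, n • (star w * w) ≤ tensorForm X φ v v := fun n => by
    have h := tensorForm_self_nonneg φ (v - (n : ℂ) • tensorAct (star w) u)
    have h1 : tensorForm X φ (v - (n : ℂ) • tensorAct (star w) u)
        (v - (n : ℂ) • tensorAct (star w) u) =
        tensorForm X φ v v - n • (star w * w) - n • (star w * w) := by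
      have h2 : tensorForm X φ u v = star w := by rw [hw, star_tensorForm]
      simp only [map_sub, LinearMap.sub_apply, LinearMap.map_smulₛₗ, LinearMap.smul_apply,
        tensorForm_act, tensorForm_act_left, hu, h2, star_star, ← hw]
      simp [Nat.cast_smul_eq_nsmul ℂ]
    rw [h1, sub_nonneg] at h
    exact h.trans (sub_le_self _ (nsmul_nonneg (star_mul_self_nonneg w) n))
  by_contra hne
  obtain ⟨n, hn⟩ := exists_nat_gt (‖tensorForm X φ v v‖ / ‖w‖ ^ 2)
  have hpos : 0 < ‖w‖ ^ 2 := by positivity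
  have h1 := CStarAlgebra.norm_le_norm_of_nonneg_of_le
    (nsmul_nonneg (star_mul_self_nonneg w) n) (key n)
  rw [← Nat.cast_smul_eq_nsmul ℝ, norm_smul, CStarRing.norm_star_mul_self, ← sq] at h1
  rw [div_lt_iff₀ hpos] at hn
  simp only [Real.norm_natCast] at h1
  exact absurd h1 (not_le.mpr hn)

variable (X)

/-- The vectors of length zero in the algebraic tensor product. -/
def nullVectors : Submodule ℂ (X ⊗[ℂ] Y) where
  carrier := {u | tensorForm X φ u u = 0}
  zero_mem' := by simp
  add_mem' {u v} hu hv := by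
    simp only [Set.mem_ofPred_eq] at hu hv ⊢
    simp [tensorForm_eq_zero φ hu, tensorForm_eq_zero φ hv]
  smul_mem' t u hu := by
    simp only [Set.mem_ofPred_eq] at hu ⊢
    simp [hu]

/-- The algebraic tensor product modulo the vectors of length zero. -/
def PreInteriorTensor : Type _ := (X ⊗[ℂ] Y) ⧸ nullVectors X φ

namespace PreInteriorTensor

instance : AddCommGroup (PreInteriorTensor X φ) :=
  inferInstanceAs (AddCommGroup ((X ⊗[ℂ] Y) ⧸ nullVectors X φ))

instance : Module ℂ (PreInteriorTensor X φ) :=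
  inferInstanceAs (Module ℂ ((X ⊗[ℂ] Y) ⧸ nullVectors X φ))

variable {X}

/-- The quotient map. -/
def mk : X ⊗[ℂ] Y →ₗ[ℂ] PreInteriorTensor X φ := (nullVectors X φ).mkQ

theorem mk_surjective : Function.Surjective (mk (X := X) φ) := (nullVectors X φ).mkQ_surjective

theorem tensorForm_congr {u u' v v' : X ⊗[ℂ] Y} (hu : mk φ u = mk φ u')
    (hv : mk φ v = mk φ v') : tensorForm X φ u v = tensorForm X φ u' v' := by
  have hu' : tensorForm X φ (u - u') (u - u') = 0 := (Submodule.Quotient.eq _).mp hu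
  have hv' : tensorForm X φ (v - v') (v - v') = 0 := (Submodule.Quotient.eq _).mp hv
  have h1 : tensorForm X φ u (v - v') = 0 := tensorForm_eq_zero φ hv' u
  have h2 : tensorForm X φ v' (u - u') = 0 := tensorForm_eq_zero φ hu' v'
  rw [map_sub, sub_eq_zero] at h1 h2
  rw [h1, ← star_tensorForm, h2, star_tensorForm]

variable (X)

instance : Inner C (PreInteriorTensor X φ) where
  inner p q := tensorForm X φ (mk_surjective φ p).choose (mk_surjective φ q).choose

instance : SMul C (PreInteriorTensor X φ) where
  smul c p := mk φ (tensorAct c (mk_surjective φ p).choose)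

instance : Norm (PreInteriorTensor X φ) := CStarModule.norm C

variable {X}

/-- The inner product of classes is the form of representatives. -/
theorem inner_mk (u v : X ⊗[ℂ] Y) : ⟪mk φ u, mk φ v⟫_C = tensorForm X φ u v :=
  tensorForm_congr φ (mk_surjective φ _).choose_spec (mk_surjective φ _).choose_spec

/-- The action on classes is the action on representatives. -/
theorem smul_mk (c : C) (u : X ⊗[ℂ] Y) : c • mk φ u = mk φ (tensorAct c u) := by
  set w := (mk_surjective φ (mk φ u)).choose with hw
  have h : mk φ w = mk φ u := (mk_surjective φ (mk φ u)).choose_spec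
  change mk φ (tensorAct c w) = mk φ (tensorAct c u)
  have h' : tensorForm X φ (w - u) (w - u) = 0 := (Submodule.Quotient.eq _).mp h
  refine (Submodule.Quotient.eq _).mpr ?_
  change tensorForm X φ (tensorAct c w - tensorAct c u) (tensorAct c w - tensorAct c u) = 0
  rw [← map_sub, tensorForm_act, tensorForm_act_left, h', zero_mul, mul_zero]

variable (X)

instance : CStarModule C (PreInteriorTensor X φ) where
  inner_add_right {p q r} := by
    obtain ⟨u, rfl⟩ := mk_surjective φ p
    obtain ⟨v, rfl⟩ := mk_surjective φ q
    obtain ⟨w, rfl⟩ := mk_surjective φ r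
    rw [← map_add, inner_mk, inner_mk, inner_mk, map_add]
  inner_self_nonneg {p} := by
    obtain ⟨u, rfl⟩ := mk_surjective φ p
    rw [inner_mk]
    exact tensorForm_self_nonneg φ u
  inner_self {p} := by
    obtain ⟨u, rfl⟩ := mk_surjective φ p
    rw [inner_mk]
    exact ((nullVectors X φ).mkQ_apply u ▸ (Submodule.Quotient.mk_eq_zero _).symm :
      u ∈ nullVectors X φ ↔ mk φ u = 0)
  inner_op_smul_right {c p q} := by
    obtain ⟨u, rfl⟩ := mk_surjective φ p
    obtain ⟨v, rfl⟩ := mk_surjective φ q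
    rw [smul_mk, inner_mk, inner_mk, tensorForm_act]
  inner_smul_right_complex {t p q} := by
    obtain ⟨u, rfl⟩ := mk_surjective φ p
    obtain ⟨v, rfl⟩ := mk_surjective φ q
    rw [← map_smul, inner_mk, inner_mk, map_smul]
  star_inner p q := by
    obtain ⟨u, rfl⟩ := mk_surjective φ p
    obtain ⟨v, rfl⟩ := mk_surjective φ q
    rw [inner_mk, inner_mk, star_tensorForm]
  norm_eq_sqrt_norm_inner_self _ := rfl

instance : NormedAddCommGroup (PreInteriorTensor X φ) := CStarModule.normedAddCommGroup C

instance : NormedSpace ℂ (PreInteriorTensor X φ) := .ofCore (CStarModule.normedSpaceCore C)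

end PreInteriorTensor

/-- The interior tensor product `X ⊗_φ Y`: the completion of the algebraic tensor product modulo
the vectors of length zero. -/
abbrev InteriorTensor : Type _ := UniformSpace.Completion (PreInteriorTensor X φ)

variable {X}

/-- The elementary tensor `x ⊗ y` in `X ⊗_φ Y`. -/
def InteriorTensor.tmul (x : X) (y : Y) : InteriorTensor X φ :=
  (PreInteriorTensor.mk φ (x ⊗ₜ y) : PreInteriorTensor X φ)

theorem InteriorTensor.inner_tmul (x x' : X) (y y' : Y) :
    ⟪tmul φ x y, tmul φ x' y'⟫_C = ⟪y, (φ (unop ⟪x, x'⟫_Aᵐᵒᵖ)).1 y'⟫_C := by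
  rw [tmul, tmul, completion_inner_coe, PreInteriorTensor.inner_mk, tensorForm_tmul]

end InteriorTensor

end HilbertModule

end

/-!
The rectangles `s ×ˢ t` are cofinal among the finite subsets of `ℕ × ℕ`. On an elementary tensor
`u ⊗ v`, the frame operator of the rectangle `s ×ˢ t` is
`∑_{i ∈ s} x_i ⊗ S_t (φ (x_i | u) v)`, where `S_t` is the frame operator of `y`. Letting first `t`
and then `s` grow gives `∑_{i ∈ s} x_i (x_i | u) ⊗ v` and then `u ⊗ v`, because the tensor map is
bounded.

Frame operators form an increasing net of positive operators. If such a net converges to the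
identity along one cofinal filter on a set with dense linear span, it is bounded by the identity,
and `‖w - T w‖² ≤ ‖w‖ ‖w - S w‖` for `0 ≤ S ≤ T ≤ 1` then yields pointwise convergence of the whole
net. For bounded self-adjoint nets this is strict convergence. The criterion passes from iterated
limits to the net of finite subsets, and from a sequence of partial sums to that net.
-/

namespace HilbertModule

section Span

variable {𝕜 V W α : Type*} [NontriviallyNormedField 𝕜] [SeminormedAddCommGroup V]
  [NormedSpace 𝕜 V] [SeminormedAddCommGroup W] [NormedSpace 𝕜 W] {l : Filter α}
  {F : α → V →L[𝕜] W} {f : V →L[𝕜] W} {S : Set V}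

theorem tendsto_apply_of_mem_span (hS : ∀ v ∈ S, Tendsto (fun a => F a v) l (𝓝 (f v))) {v : V}
    (hv : v ∈ Submodule.span 𝕜 S) : Tendsto (fun a => F a v) l (𝓝 (f v)) := by
  induction hv using Submodule.span_induction with
  | mem v hv => exact hS v hv
  | zero => simpa using tendsto_const_nhds
  | add v w _ _ hv hw => simpa using hv.add hw
  | smul t v _ hv => simpa using hv.const_smul t

theorem tendsto_apply_of_mem_topologicalClosure_span {M : ℝ} (hF : ∀ a, ‖F a‖ ≤ M)
    (hS : ∀ v ∈ S, Tendsto (fun a => F a v) l (𝓝 (f v))) {v : V}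
    (hv : v ∈ (Submodule.span 𝕜 S).topologicalClosure) :
    Tendsto (fun a => F a v) l (𝓝 (f v)) := by
  have hequi : Equicontinuous fun a => ⇑(F a) := by
    have hiff : Equicontinuous ((↑) ∘ F) ↔ ∃ C, ∀ a, ‖F a‖ ≤ C :=
      (NormedSpace.equicontinuous_TFAE F).out 1 5
    exact hiff.mpr ⟨M, hF⟩
  exact (hequi.isClosed_setOfPred_tendsto f.continuous).closure_subset_iff.mpr
    (fun w hw => tendsto_apply_of_mem_span hS hw) hv

end Span

section FunctionalCalculus

variable {A : Type*} [NonUnitalCStarAlgebra A]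

theorem abs_mul_one_sub_sq_div_max_sq_le (t : ℝ) {ε : ℝ} (hε : 0 < ε) :
    |t * (1 - t ^ 2 / max (ε ^ 2) (t ^ 2)) ^ 2| ≤ ε := by
  rcases le_total (ε ^ 2) (t ^ 2) with h | h
  · rw [max_eq_right h, div_self (by nlinarith [sq_pos_of_pos hε])]
    simpa using hε.le
  · have hratio : t ^ 2 / max (ε ^ 2) (t ^ 2) ≤ 1 :=
      div_le_one_of_le₀ (le_max_right _ _) (by positivity)
    rw [abs_mul, abs_sq]
    exact (mul_le_of_le_one_right (abs_nonneg t)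
      (pow_le_one₀ (sub_nonneg.mpr hratio) (sub_le_self _ (by positivity)))).trans
      (abs_le_of_sq_le_sq h hε.le)

open scoped ContinuousMapZero in
theorem exists_norm_conj_one_sub_mul_le {c : A} (hc : IsSelfAdjoint c) {ε : ℝ} (hε : 0 < ε) :
    ∃ a : A, IsSelfAdjoint (a * c) ∧
      ‖c - a * c * c - c * (a * c) + a * c * c * (a * c)‖ ≤ ε := by
  -- `a` is an approximate inverse of `c`: the function below is `1 / t` as soon as `ε ≤ |t|`.
  let x : C(quasispectrum ℝ c, ℝ)₀ := .id (quasispectrum ℝ c)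
  let g : C(quasispectrum ℝ c, ℝ)₀ :=
    ⟨⟨fun t => t / max (ε ^ 2) ((t : ℝ) ^ 2),
      continuous_subtype_val.div (by fun_prop) fun t => by positivity⟩, by simp⟩
  have hx : cfcₙHom hc x = c := cfcₙHom_id hc
  refine ⟨cfcₙHom hc g, ?_, ?_⟩
  · have hgx : cfcₙHom hc (g * x) = cfcₙHom hc g * c := by rw [map_mul, hx]
    exact hgx ▸ (IsSelfAdjoint.all (g * x)).map _
  have hcalc : c - cfcₙHom hc g * c * c - c * (cfcₙHom hc g * c) +
      cfcₙHom hc g * c * c * (cfcₙHom hc g * c) =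
      cfcₙHom hc (x - g * x * x - x * (g * x) + g * x * x * (g * x)) := by
    simp only [map_add, map_sub, map_mul, hx]
  rw [hcalc, norm_cfcₙHom c _ hc, ContinuousMapZero.norm_def, ContinuousMap.norm_le _ hε.le]
  rintro ⟨t, ht⟩
  refine (congrArg abs ?_).trans_le (abs_mul_one_sub_sq_div_max_sq_le t hε)
  change t - t / max (ε ^ 2) (t ^ 2) * t * t - t * (t / max (ε ^ 2) (t ^ 2) * t) +
    t / max (ε ^ 2) (t ^ 2) * t * t * (t / max (ε ^ 2) (t ^ 2) * t) = _
  ring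

theorem exists_isSelfAdjoint_smul_sub_mul_self_eq {a : A} (ha : IsSelfAdjoint a) :
    ∃ d : A, IsSelfAdjoint d ∧ (2 * √‖a‖) • d - d * d = a := by
  -- Completing the square, `d` solves `(√‖a‖ - d) ^ 2 = ‖a‖ - a`.
  obtain ⟨f, hf, hf0, hfsq⟩ : ∃ f : ℝ → ℝ, Continuous f ∧ f 0 = 0 ∧
      ∀ t ≤ ‖a‖, (2 * √‖a‖) • f t - f t * f t = t := by
    refine ⟨fun t => √‖a‖ - √(‖a‖ - t), by fun_prop, by simp, fun t ht => ?_⟩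
    rw [smul_eq_mul]
    linear_combination Real.sq_sqrt (norm_nonneg a) - Real.sq_sqrt (sub_nonneg.mpr ht)
  refine ⟨cfcₙ f a, cfcₙ_predicate f a, ?_⟩
  calc (2 * √‖a‖) • cfcₙ f a - cfcₙ f a * cfcₙ f a
      = cfcₙ (fun t => (2 * √‖a‖) • f t - f t * f t) a := by
        rw [cfcₙ_sub .., cfcₙ_smul .., cfcₙ_mul ..]
    _ = cfcₙ (fun t => t) a := cfcₙ_congr fun t ht => hfsq t <| (le_abs_self t).trans <|
        NonUnitalIsometricContinuousFunctionalCalculus.norm_quasispectrum_le a ht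
    _ = a := cfcₙ_id' ℝ a

end FunctionalCalculus

section IteratedLimit

variable {α β Z : Type*} {l : Filter α} {m : Filter β}

theorem tendsto_curry_of_tendsto [TopologicalSpace Z] {F : α → β → Z} {G : α → Z} {z : Z}
    (hF : ∀ a, Tendsto (F a) m (𝓝 (G a))) (hG : Tendsto G l (𝓝 z)) :
    Tendsto (fun p : α × β => F p.1 p.2) (l.curry m) (𝓝 z) := by
  refine tendsto_nhds.mpr fun U hU hz => eventually_curry_iff.mpr ?_
  filter_upwards [hG.eventually_mem (hU.mem_nhds hz)] with a ha
  exact (hF a).eventually_mem (hU.mem_nhds ha)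

instance curry_neBot [l.NeBot] [m.NeBot] : (l.curry m).NeBot where
  ne' h := by
    have hfalse : ∀ᶠ _ in l, ∀ᶠ _ in m, False :=
      eventually_curry_iff.mp (h ▸ eventually_bot (p := fun _ => False))
    simp [NeBot.ne] at hfalse

theorem tendsto_finset_product_curry_atTop :
    Tendsto (fun p : Finset α × Finset β => p.1 ×ˢ p.2) (atTop.curry atTop) atTop := by
  refine Tendsto.mono_left ?_ curry_le_prod
  rw [prod_atTop_atTop_eq]
  exact tendsto_atTop_finset_of_monotone (fun _ _ h => Finset.product_subset_product h.1 h.2)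
    fun ⟨i, k⟩ => ⟨({i}, {k}), by simp⟩

end IteratedLimit

section Frame

variable {C E : Type*} [NonUnitalCStarAlgebra C] [PartialOrder C] [StarOrderedRing C]
  [NormedAddCommGroup E] [NormedSpace ℂ E] [SMul C E] [CStarModule C E]

theorem norm_sq_le_mul_of_inner_self_le {F : Type*} [NormedAddCommGroup F] [NormedSpace ℂ F]
    [SMul C F] [CStarModule C F] {u : F} {v w : E} (h : ⟪u, u⟫_C ≤ ⟪v, w⟫_C) :
    ‖u‖ ^ 2 ≤ ‖v‖ * ‖w‖ :=
  (CStarModule.norm_sq_eq C).trans_le <|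
    (CStarAlgebra.norm_le_norm_of_nonneg_of_le CStarModule.inner_self_nonneg h).trans
      (CStarModule.norm_inner_le (A := C) E)

namespace Adjointable

theorem map_smul (T : Adjointable C E) (c : C) (w : E) : T.1 (c • w) = c • T.1 w :=
  ext_inner C fun z => by simp only [inner_right, CStarModule.inner_op_smul_right]

theorem ext_inner_self {S T : Adjointable C E} (h : ∀ w, ⟪w, S.1 w⟫_C = ⟪w, T.1 w⟫_C) :
    S = T := by
  refine Subtype.ext <| ContinuousLinearMap.ext fun w => ext_inner C fun v => ?_
  have hadd := h (v + w)
  have hI := h (v + Complex.I • w)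
  simp only [map_add, _root_.map_smul, CStarModule.inner_add_left, CStarModule.inner_add_right,
    CStarModule.inner_smul_left_complex, CStarModule.inner_smul_right_complex, Complex.star_def,
    Complex.conj_I, h v, h w] at hadd hI
  have hsum : ⟪v, S.1 w⟫_C + ⟪w, S.1 v⟫_C = ⟪v, T.1 w⟫_C + ⟪w, T.1 v⟫_C := by
    linear_combination (norm := module) hadd
  have hdiff : ⟪v, S.1 w⟫_C - ⟪w, S.1 v⟫_C = ⟪v, T.1 w⟫_C - ⟪w, T.1 v⟫_C :=
    smul_right_injective C Complex.I_ne_zero <| by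
      linear_combination (norm := module) hI
  linear_combination (norm := module) (1 / 2 : ℂ) • hsum + (1 / 2 : ℂ) • hdiff

instance : StarModule ℂ (Adjointable C E) where
  star_smul t T := ext_inner_self fun w => by
    rw [← inner_left]
    simp [← inner_left]

/-- The Loewner order on adjointable operators. -/
instance : PartialOrder (Adjointable C E) where
  le S T := ∀ w, ⟪w, S.1 w⟫_C ≤ ⟪w, T.1 w⟫_C
  le_refl _ _ := le_rfl
  le_trans _ _ _ h h' w := (h w).trans (h' w)
  le_antisymm _ _ h h' := ext_inner_self fun w => (h w).antisymm (h' w)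

theorem le_def {S T : Adjointable C E} : S ≤ T ↔ ∀ w, ⟪w, S.1 w⟫_C ≤ ⟪w, T.1 w⟫_C := Iff.rfl

theorem nonneg_iff {T : Adjointable C E} : 0 ≤ T ↔ ∀ w, 0 ≤ ⟪w, T.1 w⟫_C := by
  simp [le_def]

instance : IsOrderedAddMonoid (Adjointable C E) where
  add_le_add_left S T h R w := by
    simpa using h w

theorem star_mul_self_nonneg (T : Adjointable C E) : 0 ≤ star T * T :=
  nonneg_iff.mpr fun w => by
    change 0 ≤ ⟪w, (star T).1 (T.1 w)⟫_C
    rw [← inner_left]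
    exact CStarModule.inner_self_nonneg

theorem isSelfAdjoint_of_nonneg {T : Adjointable C E} (hT : 0 ≤ T) : IsSelfAdjoint T :=
  ext_inner_self fun w => by
    rw [← inner_left, ← CStarModule.star_inner, (nonneg_iff.mp hT w).isSelfAdjoint.star_eq]

theorem inner_apply_apply_le {T : Adjointable C E} (h0 : 0 ≤ T) (h1 : T ≤ 1) (w : E) :
    ⟪T.1 w, T.1 w⟫_C ≤ ⟪w, T.1 w⟫_C := by
  have hT : ∀ v v', ⟪T.1 v, v'⟫_C = ⟪v, T.1 v'⟫_C := fun v v' => by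
    rw [inner_left, isSelfAdjoint_of_nonneg h0]
  have hsum : ⟪w, T.1 w⟫_C - ⟪T.1 w, T.1 w⟫_C =
      ⟪w - T.1 w, T.1 (w - T.1 w)⟫_C + (⟪T.1 w, T.1 w⟫_C - ⟪T.1 w, T.1 (T.1 w)⟫_C) := by
    simp only [map_sub, CStarModule.inner_sub_left, CStarModule.inner_sub_right, hT]
    abel
  rw [← sub_nonneg, hsum]
  exact add_nonneg (nonneg_iff.mp h0 _) (sub_nonneg.mpr (h1 (T.1 w)))

theorem norm_apply_le {T : Adjointable C E} (h0 : 0 ≤ T) (h1 : T ≤ 1) (w : E) :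
    ‖T.1 w‖ ≤ ‖w‖ := by
  have hsq : ‖T.1 w‖ ^ 2 ≤ ‖w‖ * ‖w‖ :=
    norm_sq_le_mul_of_inner_self_le ((inner_apply_apply_le h0 h1 w).trans (h1 w))
  exact abs_le_of_sq_le_sq' (by rwa [sq ‖w‖]) (norm_nonneg w) |>.2

theorem norm_le_one {T : Adjointable C E} (h0 : 0 ≤ T) (h1 : T ≤ 1) : ‖T‖ ≤ 1 :=
  ContinuousLinearMap.opNorm_le_bound _ zero_le_one fun w => by
    simpa using norm_apply_le h0 h1 w

theorem norm_sub_apply_sq_le {S T : Adjointable C E} (h0 : 0 ≤ T) (h1 : T ≤ 1) (hST : S ≤ T)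
    (w : E) : ‖w - T.1 w‖ ^ 2 ≤ ‖w‖ * ‖w - S.1 w‖ :=
  norm_sq_le_mul_of_inner_self_le <|
    (inner_apply_apply_le (sub_nonneg.mpr h1) (sub_le_self 1 h0) w).trans
      (sub_le_sub_left hST 1 w)

end Adjointable

theorem map_le_norm_smul_one {A : Type*} [NonUnitalCStarAlgebra A]
    (φ : A →⋆ₙₐ[ℂ] Adjointable C E) {a : A} (ha : IsSelfAdjoint a) :
    φ a ≤ (‖a‖ : ℂ) • 1 := by
  obtain ⟨d, hd, hda⟩ := exists_isSelfAdjoint_smul_sub_mul_self_eq ha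
  have hself : IsSelfAdjoint ((√‖a‖ : ℂ) • 1 - φ d) :=
    (IsSelfAdjoint.smul (r := (√‖a‖ : ℂ)) (Complex.conj_ofReal _) (.one _)).sub (hd.map φ)
  have hφa : φ a = (2 * √‖a‖ : ℂ) • φ d - φ d * φ d := by
    rw [← map_mul, ← map_smul, ← map_sub, ← Complex.ofReal_ofNat, ← Complex.ofReal_mul,
      Complex.coe_smul, hda]
  have hsqrt : (√‖a‖ : ℂ) * √‖a‖ = ‖a‖ := by exact_mod_cast Real.mul_self_sqrt (norm_nonneg a)
  have hsq : ((‖a‖ : ℂ) • 1 - φ a : Adjointable C E) =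
      star ((√‖a‖ : ℂ) • 1 - φ d) * ((√‖a‖ : ℂ) • 1 - φ d) := by
    rw [hself.star_eq, hφa, ← hsqrt]
    simp only [mul_sub, sub_mul, smul_mul_assoc, mul_smul_comm, one_mul, mul_one]
    module
  exact sub_nonneg.mp (hsq ▸ Adjointable.star_mul_self_nonneg _)

theorem rankOne_self_nonneg (u : E) : 0 ≤ rankOne (C := C) u u :=
  Adjointable.nonneg_iff.mpr fun w => by
    rw [rankOne_apply, CStarModule.inner_op_smul_right, ← CStarModule.star_inner w u]
    exact star_mul_self_nonneg _

theorem norm_rankOne_le (u v : E) : ‖rankOne (C := C) u v‖ ≤ ‖u‖ * ‖v‖ :=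
  ContinuousLinearMap.opNorm_le_bound _ (by positivity) fun w => by
    calc ‖⟪v, w⟫_C • u‖ ≤ ‖⟪v, w⟫_C‖ * ‖u‖ := norm_smul_le' C _ _
      _ ≤ ‖v‖ * ‖w‖ * ‖u‖ := by gcongr; exact CStarModule.norm_inner_le E
      _ = ‖u‖ * ‖v‖ * ‖w‖ := by ring

theorem continuous_rankOne_left (v : E) : Continuous fun u : E => rankOne (C := C) u v :=
  AddMonoidHomClass.continuous_of_bound
    (AddMonoidHom.mk' (fun u => rankOne (C := C) u v) fun u u' =>
      Subtype.ext <| ContinuousLinearMap.ext fun _ => smul_add' C _ u u')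
    ‖v‖ fun u => (norm_rankOne_le u v).trans_eq (mul_comm _ _)

theorem continuous_rankOne_right (u : E) : Continuous fun v : E => rankOne (C := C) u v :=
  AddMonoidHomClass.continuous_of_bound
    (AddMonoidHom.mk' (fun v => rankOne (C := C) u v) fun v v' =>
      Subtype.ext <| ContinuousLinearMap.ext fun w => by simp [rankOne_apply, add_smul'])
    ‖u‖ (norm_rankOne_le u)

theorem mul_rankOne (T : Adjointable C E) (u v : E) : T * rankOne u v = rankOne (T.1 u) v :=
  Subtype.ext <| ContinuousLinearMap.ext fun w => Adjointable.map_smul T ⟪v, w⟫_C u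

theorem rankOne_mul (u v : E) (T : Adjointable C E) :
    rankOne u v * T = rankOne u ((star T).1 v) :=
  Subtype.ext <| ContinuousLinearMap.ext fun w => congrArg (· • u) (Adjointable.inner_right T v w)

theorem rankOne_mem_compacts (u v : E) : rankOne u v ∈ compacts C E :=
  Submodule.le_topologicalClosure _ (Submodule.subset_span ⟨(u, v), rfl⟩)

variable (C) in
theorem mem_closure_range_rankOne_self (u : E) :
    u ∈ closure (Set.range (rankOne (C := C) u u).1) := by
  refine Metric.mem_closure_range_iff.mpr fun ε hε => ?_
  obtain ⟨a, ha, hle⟩ := exists_norm_conj_one_sub_mul_le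
    (CStarModule.isSelfAdjoint_inner_self (A := C) (x := u)) (show 0 < (ε / 2) ^ 2 by positivity)
  have hinner : ⟪u - (a * ⟪u, u⟫_C) • u, u - (a * ⟪u, u⟫_C) • u⟫_C =
      ⟪u, u⟫_C - a * ⟪u, u⟫_C * ⟪u, u⟫_C - ⟪u, u⟫_C * (a * ⟪u, u⟫_C) +
        a * ⟪u, u⟫_C * ⟪u, u⟫_C * (a * ⟪u, u⟫_C) := by
    simp only [CStarModule.inner_sub_left, CStarModule.inner_sub_right,
      CStarModule.inner_op_smul_left, CStarModule.inner_op_smul_right, ha.star_eq, mul_sub,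
      mul_assoc]
    abel
  have hsq : ‖u - (a * ⟪u, u⟫_C) • u‖ ^ 2 ≤ (ε / 2) ^ 2 := by
    rwa [CStarModule.norm_sq_eq C, hinner]
  refine ⟨a • u, ?_⟩
  rw [dist_eq_norm, rankOne_apply, CStarModule.inner_op_smul_right]
  exact (abs_le_of_sq_le_sq' hsq (by positivity)).2.trans_lt (half_lt_self hε)

section Strict

variable {α : Type*} {l : Filter α} {T : α → Adjointable C E}

theorem tendsto_strict_one_iff :
    Tendsto T l (@nhds _ (strictTopology C E) 1) ↔
      ∀ K ∈ compacts C E, Tendsto (fun a => T a * K) l (𝓝 K) ∧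
        Tendsto (fun a => K * T a) l (𝓝 K) := by
  rw [nhds_induced, tendsto_comap_iff, tendsto_pi_nhds]
  simp only [Function.comp_def, Subtype.forall, one_mul, mul_one]
  refine forall₂_congr fun K hK => ?_
  rw [nhds_prod_eq, tendsto_prod_iff']

theorem tendsto_apply_apply_of_tendsto_strict_one
    (hT : Tendsto T l (@nhds _ (strictTopology C E) 1)) {K : Adjointable C E}
    (hK : K ∈ compacts C E) (w : E) : Tendsto (fun a => (T a).1 (K.1 w)) l (𝓝 (K.1 w)) :=
  (((ContinuousLinearMap.apply ℂ E w).continuous.comp continuous_subtype_val).tendsto K).comp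
    (tendsto_strict_one_iff.mp hT K hK).1

theorem tendsto_strict_one_of_tendsto_apply {M : ℝ} (hM : ∀ a, ‖T a‖ ≤ M)
    (hT : ∀ w, Tendsto (fun a => (T a).1 w) l (𝓝 w))
    (hstar : ∀ w, Tendsto (fun a => (star (T a)).1 w) l (𝓝 w)) :
    Tendsto T l (@nhds _ (strictTopology C E) 1) := by
  let mulₗ := ContinuousLinearMap.mul ℂ (Adjointable C E)
  refine tendsto_strict_one_iff.mpr fun K hK => ⟨?_, ?_⟩
  · refine tendsto_apply_of_mem_topologicalClosure_span (F := fun a => mulₗ (T a)) (f := .id ℂ _)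
      (fun a => (ContinuousLinearMap.opNorm_mul_apply_le ℂ _ (T a)).trans (hM a)) ?_ hK
    rintro _ ⟨⟨u, v⟩, rfl⟩
    exact (((continuous_rankOne_left v).tendsto u).comp (hT u)).congr fun a =>
      (mul_rankOne (T a) u v).symm
  · refine tendsto_apply_of_mem_topologicalClosure_span (F := fun a => mulₗ.flip (T a))
      (f := .id ℂ _) (M := M) (fun a => ?_) ?_ hK
    · exact ContinuousLinearMap.opNorm_le_bound _ ((norm_nonneg _).trans (hM a)) fun K =>
        (norm_mul_le K (T a)).trans
          (by rw [mul_comm]; exact mul_le_mul_of_nonneg_right (hM a) (norm_nonneg K))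
    · rintro _ ⟨⟨u, v⟩, rfl⟩
      exact (((continuous_rankOne_right u).tendsto v).comp (hstar v)).congr fun a =>
        (rankOne_mul u v (T a)).symm

end Strict

section MonotoneNet

variable {α β : Type*} [Preorder β] {T : β → Adjointable C E} {l : Filter α} [l.NeBot] {σ : α → β}
  {D : Set E}

theorem le_one_of_monotone_of_tendsto_apply (hmono : Monotone T) (hσ : Tendsto σ l atTop)
    (hD : Dense (Submodule.span ℂ D : Set E))
    (hlim : ∀ w ∈ D, Tendsto (fun a => (T (σ a)).1 w) l (𝓝 w)) (b : β) : T b ≤ 1 := by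
  have hclosed : IsClosed {w : E | ⟪w, (T b).1 w⟫_C ≤ ⟪w, w⟫_C} :=
    isClosed_le (CStarModule.continuous_inner.comp (continuous_id.prodMk (T b).1.continuous))
      (CStarModule.continuous_inner.comp (continuous_id.prodMk continuous_id))
  intro w
  refine hclosed.closure_subset_iff.mpr (fun v hv => ?_) (hD w)
  have hv : Tendsto (fun a => (T (σ a)).1 v) l (𝓝 v) :=
    tendsto_apply_of_mem_span (f := .id ℂ E) hlim hv
  have hinner : Tendsto (fun a => ⟪v, (T (σ a)).1 v⟫_C) l (𝓝 ⟪v, v⟫_C) :=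
    (CStarModule.continuous_inner.tendsto (v, v)).comp (tendsto_const_nhds.prodMk_nhds hv)
  refine ge_of_tendsto hinner ?_
  filter_upwards [hσ.eventually_ge_atTop b] with a ha using hmono ha v

variable (hmono : Monotone T) (hnonneg : ∀ b, 0 ≤ T b) (hσ : Tendsto σ l atTop)
  (hD : Dense (Submodule.span ℂ D : Set E))
  (hlim : ∀ w ∈ D, Tendsto (fun a => (T (σ a)).1 w) l (𝓝 w))
include hmono hnonneg hσ hD hlim

theorem tendsto_apply_of_monotone (w : E) : Tendsto (fun b => (T b).1 w) atTop (𝓝 w) := by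
  have hone := le_one_of_monotone_of_tendsto_apply hmono hσ hD hlim
  have hw : Tendsto (fun a => (T (σ a)).1 w) l (𝓝 w) :=
    tendsto_apply_of_mem_topologicalClosure_span (f := .id ℂ E)
      (fun a => Adjointable.norm_le_one (hnonneg _) (hone _)) hlim (hD w)
  have hnorm : Tendsto (fun a => ‖w‖ * ‖w - (T (σ a)).1 w‖) l (𝓝 0) := by
    simpa using (hw.const_sub w).norm.const_mul ‖w‖
  refine Metric.tendsto_nhds.mpr fun ε hε => ?_
  obtain ⟨a, ha⟩ := (hnorm.eventually_lt_const (show 0 < ε ^ 2 by positivity)).exists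
  filter_upwards [eventually_ge_atTop (σ a)] with b hb
  rw [dist_comm, dist_eq_norm]
  exact lt_of_pow_lt_pow_left₀ 2 hε.le <|
    (Adjointable.norm_sub_apply_sq_le (hnonneg b) (hone b) (hmono hb) w).trans_lt ha

theorem tendsto_strict_one_of_monotone :
    Tendsto T atTop (@nhds _ (strictTopology C E) 1) := by
  have hw := tendsto_apply_of_monotone hmono hnonneg hσ hD hlim
  have hone := le_one_of_monotone_of_tendsto_apply hmono hσ hD hlim
  refine tendsto_strict_one_of_tendsto_apply
    (fun b => Adjointable.norm_le_one (hnonneg b) (hone b)) hw fun w => (hw w).congr fun b => ?_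
  rw [(Adjointable.isSelfAdjoint_of_nonneg (hnonneg b)).star_eq]

end MonotoneNet

variable {ι : Type*}

variable (C) in
/-- The frame operator `∑_{i ∈ s} Θ_{z_i, z_i}` of a finite part of a family `z`. -/
noncomputable def frameSum (z : ι → E) (s : Finset ι) : Adjointable C E :=
  ∑ i ∈ s, rankOne (z i) (z i)

theorem frameSum_apply (z : ι → E) (s : Finset ι) (w : E) :
    (frameSum C z s).1 w = ∑ i ∈ s, ⟪z i, w⟫_C • z i := by
  simp [frameSum, rankOne_apply]

theorem frameSum_nonneg (z : ι → E) (s : Finset ι) : 0 ≤ frameSum C z s :=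
  Finset.sum_nonneg fun i _ => rankOne_self_nonneg (z i)

theorem frameSum_mono (z : ι → E) : Monotone (frameSum C z) := fun _ _ h =>
  Finset.sum_le_sum_of_subset_of_nonneg h fun i _ _ => rankOne_self_nonneg (z i)

theorem isUnorderedFrame_of_tendsto_apply {z : ι → E} {α : Type*} {l : Filter α} [l.NeBot]
    {σ : α → Finset ι} (hσ : Tendsto σ l atTop) {D : Set E}
    (hD : Dense (Submodule.span ℂ D : Set E))
    (hlim : ∀ w ∈ D, Tendsto (fun a => (frameSum C z (σ a)).1 w) l (𝓝 w)) :
    IsUnorderedFrame C z :=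
  tendsto_strict_one_of_monotone (frameSum_mono z) (frameSum_nonneg z) hσ hD hlim

variable (C E) in
theorem dense_span_range_rankOne_self_apply :
    Dense (Submodule.span ℂ (Set.range fun p : E × E => (rankOne (C := C) p.1 p.1).1 p.2) :
      Set E) := fun u =>
  closure_mono
    (Set.range_subset_iff.mpr fun w => Submodule.subset_span (Set.mem_range_self (u, w)))
    (mem_closure_range_rankOne_self C u)

theorem IsUnorderedFrame.tendsto_frameSum_apply {z : ι → E} (hz : IsUnorderedFrame C z) (w : E) :
    Tendsto (fun s => (frameSum C z s).1 w) atTop (𝓝 w) := by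
  refine tendsto_apply_of_monotone (frameSum_mono z) (frameSum_nonneg z) tendsto_id
    (dense_span_range_rankOne_self_apply C E) ?_ w
  rintro _ ⟨⟨u, v⟩, rfl⟩
  exact tendsto_apply_apply_of_tendsto_strict_one hz (rankOne_mem_compacts u u) v

theorem IsCountableFrame.isUnorderedFrame {z : ℕ → E} (hz : IsCountableFrame C z) :
    IsUnorderedFrame C z := by
  refine isUnorderedFrame_of_tendsto_apply tendsto_finset_range
    (dense_span_range_rankOne_self_apply C E) ?_
  rintro _ ⟨⟨u, v⟩, rfl⟩
  exact tendsto_apply_apply_of_tendsto_strict_one hz (rankOne_mem_compacts u u) v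

theorem IsUnorderedFrame.isCountableFrame {z : ι → E} (hz : IsUnorderedFrame C z) (e : ℕ ≃ ι) :
    IsCountableFrame C (fun n => z (e n)) := by
  have hrange : Tendsto (fun n => (Finset.range n).map e.toEmbedding) atTop atTop :=
    tendsto_atTop_finset_of_monotone
      (fun m n h => Finset.map_subset_map.mpr (Finset.range_mono h))
      fun i => ⟨e.symm i + 1, by simp⟩
  exact (hz.comp hrange).congr fun n => by simp

end Frame

section Tensor

variable {A C X Y : Type*} [NonUnitalCStarAlgebra A] [PartialOrder A] [StarOrderedRing A]
  [NonUnitalCStarAlgebra C] [PartialOrder C] [StarOrderedRing C]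
  [NormedAddCommGroup X] [NormedSpace ℂ X] [SMul Aᵐᵒᵖ X] [CStarModule Aᵐᵒᵖ X]
  [NormedAddCommGroup Y] [NormedSpace ℂ Y] [SMul C Y] [CStarModule C Y]
  (φ : A →⋆ₙₐ[ℂ] Adjointable C Y)

namespace InteriorTensor

theorem norm_tmul_le (x : X) (y : Y) : ‖tmul φ x y‖ ≤ ‖x‖ * ‖y‖ := by
  have hself : IsSelfAdjoint (unop ⟪x, x⟫_Aᵐᵒᵖ) :=
    congrArg unop (CStarModule.star_inner (A := Aᵐᵒᵖ) x x)
  have hle : ⟪tmul φ x y, tmul φ x y⟫_C ≤ ⟪y, ((‖unop ⟪x, x⟫_Aᵐᵒᵖ‖ : ℂ) • y)⟫_C := by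
    rw [inner_tmul]
    exact map_le_norm_smul_one φ hself y
  have hnorm : ‖unop ⟪x, x⟫_Aᵐᵒᵖ‖ = ‖x‖ ^ 2 := (CStarModule.norm_sq_eq Aᵐᵒᵖ).symm
  have hsq : ‖tmul φ x y‖ ^ 2 ≤ (‖x‖ * ‖y‖) ^ 2 := by
    calc ‖tmul φ x y‖ ^ 2 ≤ ‖y‖ * ‖(‖unop ⟪x, x⟫_Aᵐᵒᵖ‖ : ℂ) • y‖ :=
          norm_sq_le_mul_of_inner_self_le hle
      _ = (‖x‖ * ‖y‖) ^ 2 := by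
        rw [hnorm, norm_smul, Complex.norm_real, norm_pow, norm_norm]
        ring
  exact (abs_le_of_sq_le_sq' hsq (by positivity)).2

variable (X) in
/-- The canonical map from the algebraic tensor product to the interior tensor product. -/
noncomputable def ofTensor : X ⊗[ℂ] Y →ₗ[ℂ] InteriorTensor X φ :=
  (UniformSpace.Completion.toComplL (𝕜 := ℂ) (E := PreInteriorTensor X φ)).toLinearMap ∘ₗ
    PreInteriorTensor.mk φ

theorem denseRange_ofTensor : DenseRange (ofTensor X φ) :=
  UniformSpace.Completion.denseRange_coe.comp (PreInteriorTensor.mk_surjective φ).denseRange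
    (UniformSpace.Completion.continuous_coe _)

theorem dense_span_range_tmul :
    Dense (Submodule.span ℂ (Set.range fun p : X × Y => tmul φ p.1 p.2) :
      Set (InteriorTensor X φ)) := by
  refine (denseRange_ofTensor φ).mono ?_
  rintro _ ⟨u, rfl⟩
  induction u with
  | zero => simp
  | add u v hu hv => simpa using add_mem hu hv
  | tmul x y => exact Submodule.subset_span ⟨(x, y), rfl⟩

/-- The elementary tensor `x ⊗ y` as a bounded bilinear map. -/
noncomputable def tmulL : X →L[ℂ] Y →L[ℂ] InteriorTensor X φ :=
  ((TensorProduct.mk ℂ X Y).compr₂ (ofTensor X φ)).mkContinuous₂ 1 fun x y =>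
    (norm_tmul_le φ x y).trans_eq (by rw [one_mul])

theorem tmulL_apply (x : X) (y : Y) : tmulL φ x y = tmul φ x y := rfl

theorem smul_tmul (c : C) (x : X) (y : Y) : c • tmul φ x y = tmul φ x (c • y) := by
  rw [tmul, ← completion_coe_smul, PreInteriorTensor.smul_mk]
  rfl

theorem tmul_op_smul (a : A) (x : X) (y : Y) :
    tmul φ (op a • x) y = tmul φ x ((φ a).1 y) := by
  rw [← sub_eq_zero]
  apply (CStarModule.inner_self (A := C)).mp
  simp [inner_tmul]

theorem frameSum_tmul_apply {ι κ : Type*} (x : ι → X) (y : κ → Y) (s : Finset ι) (t : Finset κ)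
    (u : X) (v : Y) :
    (frameSum C (fun p : ι × κ => tmul φ (x p.1) (y p.2)) (s ×ˢ t)).1 (tmul φ u v) =
      ∑ i ∈ s, tmulL φ (x i) ((frameSum C y t).1 ((φ (unop ⟪x i, u⟫_Aᵐᵒᵖ)).1 v)) := by
  rw [frameSum_apply, Finset.sum_product]
  simp only [inner_tmul, smul_tmul, frameSum_apply, map_sum, tmulL_apply]

theorem sum_tmul_apply {ι : Type*} (x : ι → X) (s : Finset ι) (u : X) (v : Y) :
    ∑ i ∈ s, tmul φ (x i) ((φ (unop ⟪x i, u⟫_Aᵐᵒᵖ)).1 v) =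
      tmulL φ ((frameSum Aᵐᵒᵖ x s).1 u) v := by
  simp only [frameSum_apply, map_sum, _root_.sum_apply, tmulL_apply, ← tmul_op_smul, op_unop]

variable {ι κ : Type*} {x : ι → X} {y : κ → Y}

theorem tendsto_frameSum_tmul_apply (hx : IsUnorderedFrame Aᵐᵒᵖ x) (hy : IsUnorderedFrame C y)
    (u : X) (v : Y) :
    Tendsto (fun p : Finset ι × Finset κ =>
      (frameSum C (fun q : ι × κ => tmul φ (x q.1) (y q.2)) (p.1 ×ˢ p.2)).1 (tmul φ u v))
      (atTop.curry atTop) (𝓝 (tmul φ u v)) := by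
  have hinner (s : Finset ι) : Tendsto
      (fun t => ∑ i ∈ s, tmulL φ (x i) ((frameSum C y t).1 ((φ (unop ⟪x i, u⟫_Aᵐᵒᵖ)).1 v)))
      atTop (𝓝 (tmulL φ ((frameSum Aᵐᵒᵖ x s).1 u) v)) := by
    rw [← sum_tmul_apply]
    exact tendsto_finsetSum _ fun i _ =>
      ((tmulL φ (x i)).continuous.tendsto _).comp (hy.tendsto_frameSum_apply _)
  have houter : Tendsto (fun s => tmulL φ ((frameSum Aᵐᵒᵖ x s).1 u) v) atTop
      (𝓝 (tmulL φ u v)) :=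
    (((tmulL φ).flip v).continuous.tendsto u).comp (hx.tendsto_frameSum_apply u)
  exact (tendsto_curry_of_tendsto hinner houter).congr fun p =>
    (frameSum_tmul_apply φ x y p.1 p.2 u v).symm

end InteriorTensor

end Tensor

end HilbertModule

open HilbertModule in
theorem mainTheorem9_general
    {A C : Type*} [NonUnitalCStarAlgebra A] [PartialOrder A] [StarOrderedRing A]
    [NonUnitalCStarAlgebra C] [PartialOrder C] [StarOrderedRing C]
    {X : Type*} [NormedAddCommGroup X] [NormedSpace ℂ X] [SMul Aᵐᵒᵖ X] [CStarModule Aᵐᵒᵖ X]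
    {Y : Type*} [NormedAddCommGroup Y] [NormedSpace ℂ Y] [SMul C Y] [CStarModule C Y]
    (φ : A →⋆ₙₐ[ℂ] Adjointable C Y) {ι κ : Type*}
    {x : ι → X} (hx : IsUnorderedFrame Aᵐᵒᵖ x) {y : κ → Y} (hy : IsUnorderedFrame C y) :
    IsUnorderedFrame C (fun p : ι × κ => InteriorTensor.tmul φ (x p.1) (y p.2)) := by
  refine isUnorderedFrame_of_tendsto_apply tendsto_finset_product_curry_atTop
    (InteriorTensor.dense_span_range_tmul φ) ?_
  rintro _ ⟨⟨u, v⟩, rfl⟩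
  exact InteriorTensor.tendsto_frameSum_tmul_apply φ hx hy u v

open HilbertModule in
theorem mainTheorem9
    {A B : Type*} [NonUnitalCStarAlgebra A] [PartialOrder A] [StarOrderedRing A]
    [NonUnitalCStarAlgebra B] [PartialOrder B] [StarOrderedRing B]
    -- `X` is a right Hilbert `A`-module, `(φ, Y)` is an `A`-`B`-correspondence
    {X : Type*} [NormedAddCommGroup X] [NormedSpace ℂ X] [CompleteSpace X]
    [SMul Aᵐᵒᵖ X] [CStarModule Aᵐᵒᵖ X]
    {Y : Type*} [NormedAddCommGroup Y] [NormedSpace ℂ Y] [CompleteSpace Y]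
    [SMul Bᵐᵒᵖ Y] [CStarModule Bᵐᵒᵖ Y]
    (φ : A →⋆ₙₐ[ℂ] Adjointable Bᵐᵒᵖ Y)
    (x : ℕ → X) (hx : IsCountableFrame Aᵐᵒᵖ x)
    (y : ℕ → Y) (hy : IsCountableFrame Bᵐᵒᵖ y) :
    IsUnorderedFrame Bᵐᵒᵖ (fun p : ℕ × ℕ => InteriorTensor.tmul φ (x p.1) (y p.2)) ∧
    ∀ e : ℕ ≃ ℕ × ℕ,
      IsCountableFrame Bᵐᵒᵖ (fun n => InteriorTensor.tmul φ (x (e n).1) (y (e n).2)) := by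
  have htensor := mainTheorem9_general φ hx.isUnorderedFrame hy.isUnorderedFrame
  exact ⟨htensor, htensor.isCountableFrame⟩
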